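/- **Setting.** Let $n,N\ge 1$ be integers and let $\lambda_0\in\mathbb C$ be purely imaginary, $\operatorname{Re}\lambda_0=0$, $\operatorname{Im}\lambda_0\neq 0$. Put $$\zeta=\frac{2\operatorname{Im}\lambda_0}{n+1},\quad \omega_j=\frac{j\pi}{n+1},\quad a_j=\zeta\csc\omega_j,\quad b_j=\zeta\cot\omega_j\quad(1\le j\le n),\quad z_0=\mathrm i\zeta,$$ $\mathbf a=(a_1,\dots,a_n)^{\mathrm T}$, $\theta_j=b_jx-(\tfrac12 b_j^2-\|\mathbf a\|_2^2)t$, $q_j^{\mathrm{bg}}=a_j\mathrm e^{\mathrm i\theta_j}$ (a plane wave solution of $\mathrm i\mathbf q_t+\frac12\mathbf q_{xx}+\|\mathbf q\|_2^2\mathbf q=0$), and $\lambda(\epsilon)=\lambda_0(1+\epsilon^{n+1})$. Let $f(z)=2\lambda_0\prod_{s=1}^n(z+b_s)$. For $k=0,\dots,n$ let $g_k$ be the holomorphic branch of $f^{1/(n+1)}$ near $z_0$ with $g_k(z_0)=|f(z_0)|^{1/(n+1)}\mathrm e^{\mathrm i(\arg f(z_0)+2k\pi)/(n+1)}$, $\arg\in(-\pi,\pi]$,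 and let $\mu_k(\epsilon)$, $\mu_k(0)=z_0$, be the local inverse function of $z\mapsto\epsilon=(z-z_0)/g_k(z)$ at $z_0$. With $$\mathbf h(z)=\operatorname{diag}(1,\mathrm e^{\mathrm i\theta_1},\dots,\mathrm e^{\mathrm i\theta_n})\Big(1,\frac{a_1}{z+b_1},\dots,\frac{a_n}{z+b_n}\Big)^{\mathrm T}\mathrm e^{\mathrm i(z-\lambda)[x+(z+\lambda)t/2]-\mathrm i(\|\mathbf a\|_2^2+\lambda^2/2)t},\qquad \lambda=\lambda(\epsilon),$$ let $\Phi_0(\epsilon)=(\mathbf h(\mu_0(\epsilon)),\dots,\mathbf h(\mu_n(\epsilon)))$, $\mathbf R_j=(g_0(z_0)^j,\dots,g_n(z_0)^j)^\dagger$, and let $\widehat\Phi_s=\widehat\Phi_s(x,t)$ be the $(n+1)\times(n+1)$ matrix with columns $\frac{1}{(s(n+1)+j)!}\Phi_0^{(s(n+1)+j)}(0)\,\mathbf R_j$, $0\le j\le n$. For constant $(n+1)\times(n+1)$ matrices $\boldsymbol\gamma_0,\dots,\boldsymbol\gamma_{N-1}$ and a constant vector $\boldsymbol\beta\in\mathbb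 C^{n+1}$ let $\widetilde\Phi_k=\sum_{s=0}^k\widehat\Phi_s\boldsymbol\gamma_{k-s}\boldsymbol\beta$, let $\mathbf Y_1,\dots,\mathbf Y_{n+1}$ be the rows of $(\widetilde\Phi_0,\dots,\widetilde\Phi_{N-1})$, and let $\mathbf M=(M_{m,k})_{0\le m,k\le N-1}$, $$M_{m,k}=\frac1{\mathrm i(n+1)\zeta}\sum_{s=0}^m\sum_{l=0}^k\Big(-\frac12\Big)^{s+l}\binom{s+l}{l}\widetilde\Phi_{m-s}^\dagger\widetilde\Phi_{k-l}.$$ The $N$-th order rogue wave with parameters $(\boldsymbol\gamma_0,\dots,\boldsymbol\gamma_{N-1},\boldsymbol\beta)$ is, wherever $\det\mathbf M\ne0$, $$q_j^{[N]}(x,t)=q_j^{\mathrm{bg}}+\frac{2}{\det\mathbf M}\det\begin{pmatrix}\mathbf M&\mathbf Y_1^\dagger\\ \mathbf Y_{j+1}&0\end{pmatrix},\qquad 1\le j\le n.$$ Let $$\mathcal{GA}[N]=\max\frac{\|\mathbf q^{[N]}(x,t)\|_1}{\|\mathbf a\|_1},\qquad \mathcal A_j[N]=\max\left|\frac{q_j^{[N]}(x,t)}{a_j}\right|,$$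 the maxima being over all $(x,t)\in\mathbb R^2$ and all parameters $\boldsymbol\gamma_0,\dots,\boldsymbol\gamma_{N-1},\boldsymbol\beta$ with $\det\mathbf M\neq0$ at $(x,t)$. Let $\boldsymbol\eta=(\sqrt n,\mathrm i,\dots,\mathrm i)^{\mathrm T}$, and let $\boldsymbol\eta_j$ be the vector with first entry $1$, $(j+1)$-th entry $\mathrm i$ and all other entries $0$. **Proposition.** The matrix $\widehat\Phi_0(0,0)$ is invertible. Choose $$\boldsymbol\gamma_0=\widehat\Phi_0(0,0)^{-1},\qquad \boldsymbol\gamma_m=-\widehat\Phi_0(0,0)^{-1}\sum_{s=0}^{m-1}\widehat\Phi_{m-s}(0,0)\boldsymbol\gamma_s\quad(1\le m\le N-1),$$ so that, for every $\boldsymbol\beta$, at $(x,t)=(0,0)$ one has $\widetilde\Phi_0=\boldsymbol\beta$ and $\widetilde\Phi_k=0$ for $1\le k\le N-1$. With these $\boldsymbol\gamma_m$: * for $\boldsymbol\beta=\boldsymbol\eta$ one has $\det\mathbf M(0,0)\ne0$, and the maximum of $\|\mathbf q^{[N]}\|_1/\|\mathbf a\|_1$ exists and is attained at $(x,t)=(0,0)$: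 $$\mathcal{GA}[N]=1+\frac{N(n+1)\sqrt n}{\sum_{j=1}^n\csc\omega_j};$$ * for each $j\in\{1,\dots,n\}$ and $\boldsymbol\beta=\boldsymbol\eta_j$ one has $\det\mathbf M(0,0)\ne0$, and the maximum of $|q_j^{[N]}/a_j|$ exists and is attained at $(x,t)=(0,0)$: $$\mathcal A_j[N]=1+N(n+1)\sin\omega_j.$$ -/

import Mathlib

noncomputable section

namespace VectorRogue

open Complex Matrix

/-! ### Plane wave background -/

/-- `ζ = 2 Im λ₀ / (n+1)`. -/
def zeta (n : ℕ) (lam0 : ℂ) : ℝ := 2 * lam0.im / (n + 1)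

/-- `ω_j = jπ/(n+1)` for `j = 1, …, n`; the index `j : Fin n` stands for the number `j + 1`. -/
def omega (n : ℕ) (j : Fin n) : ℝ := ((j : ℝ) + 1) * Real.pi / (n + 1)

/-- Background amplitudes `a_j = ζ csc ω_j`. -/
def amp (n : ℕ) (lam0 : ℂ) (j : Fin n) : ℝ := zeta n lam0 / Real.sin (omega n j)

/-- Background wave numbers `b_j = ζ cot ω_j - 2 Re λ₀`. -/
def waveNum (n : ℕ) (lam0 : ℂ) (j : Fin n) : ℝ :=
  zeta n lam0 * Real.cot (omega n j) - 2 * lam0.re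

/-- `‖a‖₂²`. -/
def ampSq (n : ℕ) (lam0 : ℂ) : ℝ := ∑ j, amp n lam0 j ^ 2

/-- `θ_j = b_j x - (b_j²/2 - ‖a‖₂²) t`. -/
def phase (n : ℕ) (lam0 : ℂ) (x t : ℝ) (j : Fin n) : ℝ :=
  waveNum n lam0 j * x - (waveNum n lam0 j ^ 2 / 2 - ampSq n lam0) * t

/-- The plane wave `q_j^bg = a_j exp(i θ_j)`. -/
def qbg (n : ℕ) (lam0 : ℂ) (x t : ℝ) (j : Fin n) : ℂ :=
  (amp n lam0 j : ℂ) * exp (I * (phase n lam0 x t j : ℂ))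

/-! ### The perturbed eigenvalues -/

/-- The `(n+1)`-fold root `z₀ = 2 Re λ₀ + i ζ`. -/
def z0 (n : ℕ) (lam0 : ℂ) : ℂ := 2 * (lam0.re : ℂ) + I * (zeta n lam0 : ℂ)

/-- The perturbed spectral parameter `λ = λ₀ (1 + ε^(n+1))`. -/
def lam (n : ℕ) (lam0 ε : ℂ) : ℂ := lam0 * (1 + ε ^ (n + 1))

/-- `f(z) = 2 λ₀ ∏_s (z + b_s)`. The characteristic polynomial of `H + λ` at
`λ = λ₀ (1 + ε^(n+1))` is `(z - z₀)^(n+1) - ε^(n+1) f(z)`. -/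
def fPoly (n : ℕ) (lam0 z : ℂ) : ℂ := 2 * lam0 * ∏ s : Fin n, (z + (waveNum n lam0 s : ℂ))

/-- The `k`-th root `g_k(z₀) = |f(z₀)|^(1/(n+1)) exp(i (arg f(z₀) + 2kπ)/(n+1))`. -/
def gRoot0 (n : ℕ) (lam0 : ℂ) (k : Fin (n + 1)) : ℂ :=
  ((‖fPoly n lam0 (z0 n lam0)‖ ^ ((1 : ℝ) / (n + 1)) : ℝ) : ℂ) *
    exp (I * ((((fPoly n lam0 (z0 n lam0)).arg + 2 * (k : ℝ) * Real.pi) / (n + 1) : ℝ) : ℂ))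

/-- The branch `g_k` of the `(n+1)`-st root of `f` that is holomorphic near `z₀` and has the
value `gRoot0` at `z₀`. (Near `z₀` the quotient `f(z)/f(z₀)` is close to `1`, so its principal
root is holomorphic there, also when `f(z₀)` is a negative real number.) -/
def gRoot (n : ℕ) (lam0 : ℂ) (k : Fin (n + 1)) (z : ℂ) : ℂ :=
  gRoot0 n lam0 k * (fPoly n lam0 z / fPoly n lam0 (z0 n lam0)) ^ ((1 : ℂ) / (n + 1))

theorem fPoly_z0_ne_zero (n : ℕ) (lam0 : ℂ) (h : lam0.im ≠ 0) :
    fPoly n lam0 (z0 n lam0) ≠ 0 := by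
  have hz : zeta n lam0 ≠ 0 := by
    unfold zeta
    have : (n : ℝ) + 1 ≠ 0 := by positivity
    exact div_ne_zero (mul_ne_zero two_ne_zero h) this
  unfold fPoly
  refine mul_ne_zero (mul_ne_zero two_ne_zero ?_) (Finset.prod_ne_zero_iff.2 ?_)
  · rintro rfl
    simp at h
  · intro s _ hs
    apply hz
    have := congrArg Complex.im hs
    simpa [z0] using this

theorem gRoot_z0 (n : ℕ) (lam0 : ℂ) (h : lam0.im ≠ 0) (k : Fin (n + 1)) :
    gRoot n lam0 k (z0 n lam0) = gRoot0 n lam0 k := by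
  simp [gRoot, div_self (fPoly_z0_ne_zero n lam0 h)]

theorem gRoot_z0_ne_zero (n : ℕ) (lam0 : ℂ) (h : lam0.im ≠ 0) (k : Fin (n + 1)) :
    gRoot n lam0 k (z0 n lam0) ≠ 0 := by
  rw [gRoot_z0 n lam0 h, gRoot0]
  refine mul_ne_zero ?_ (exp_ne_zero _)
  have := norm_pos_iff.2 (fPoly_z0_ne_zero n lam0 h)
  exact_mod_cast (Real.rpow_pos_of_pos this _).ne'

/-- `ε = (z - z₀)/g_k(z)` has the nonzero derivative `1/g_k(z₀)` at `z₀`. -/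
theorem hasStrictDerivAt_eps (n : ℕ) (lam0 : ℂ) (h : lam0.im ≠ 0) (k : Fin (n + 1)) :
    HasStrictDerivAt (fun z => (z - z0 n lam0) / gRoot n lam0 k z)
      (gRoot n lam0 k (z0 n lam0))⁻¹ (z0 n lam0) := by
  have hf := fPoly_z0_ne_zero n lam0 h
  have hg := gRoot_z0_ne_zero n lam0 h k
  have hF : ContDiff ℂ 1 (fPoly n lam0) := by
    unfold fPoly
    fun_prop
  have hF' := hF.contDiffAt.hasStrictDerivAt (x := z0 n lam0) one_ne_zero
  have hG : HasStrictDerivAt (gRoot n lam0 k) _ (z0 n lam0) :=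
    ((hF'.div_const (fPoly n lam0 (z0 n lam0))).cpow
      (hasStrictDerivAt_const (z0 n lam0) ((1 : ℂ) / (n + 1)))
      (by rw [div_self hf]; simp)).const_mul (gRoot0 n lam0 k)
  have hS : HasStrictDerivAt (fun z => z - z0 n lam0) 1 (z0 n lam0) :=
    (hasStrictDerivAt_id (z0 n lam0)).sub_const (z0 n lam0)
  refine (hS.fun_div hG hg).congr_deriv ?_
  rw [sub_self, zero_mul, sub_zero, one_mul]
  field_simp

open Classical in
/-- The eigenvalue branch `μ_k(ε)` of `H + λ`, `λ = λ₀ (1 + ε^(n+1))`, with `μ_k(0) = z₀`: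
the inverse function of `z ↦ ε = (z - z₀)/g_k(z)` near `z₀`. (The value for `Im λ₀ = 0` is
irrelevant.) -/
def mu (n : ℕ) (lam0 : ℂ) (k : Fin (n + 1)) : ℂ → ℂ :=
  if h : lam0.im ≠ 0 then
    (hasStrictDerivAt_eps n lam0 h k).localInverse _ _ _
      (inv_ne_zero (gRoot_z0_ne_zero n lam0 h k))
  else fun _ => z0 n lam0

/-! ### Wave functions and the `N`-th order solution -/

/-- The vector `h(z)` at spectral parameter `l`:
`G (1, a_1/(z+b_1), …, a_n/(z+b_n))ᵀ
  exp(i (z-l)(x + (z+l)t/2) - i (‖a‖₂² + l²/2) t)`, `G = diag(1, e^{iθ_1}, …, e^{iθ_n})`. -/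
def hVec (n : ℕ) (lam0 : ℂ) (x t : ℝ) (l z : ℂ) : Fin (n + 1) → ℂ := fun i =>
  (Fin.cons (1 : ℂ) (fun j : Fin n => exp (I * (phase n lam0 x t j : ℂ)) *
      ((amp n lam0 j : ℂ) / (z + (waveNum n lam0 j : ℂ)))) : Fin (n + 1) → ℂ) i *
    exp (I * (z - l) * (x + (z + l) * t / 2) - I * ((ampSq n lam0 : ℂ) + l ^ 2 / 2) * t)

/-- `Φ₀(ε) = (h(μ_0), …, h(μ_n))`. -/
def Phi0 (n : ℕ) (lam0 : ℂ) (x t : ℝ) (ε : ℂ) : Matrix (Fin (n + 1)) (Fin (n + 1)) ℂ :=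
  Matrix.of fun i k => hVec n lam0 x t (lam n lam0 ε) (mu n lam0 k ε) i

/-- The column vector `R_j = (g_0(z₀)^j, …, g_n(z₀)^j)^†`. -/
def RVec (n : ℕ) (lam0 : ℂ) (j : ℕ) : Fin (n + 1) → ℂ :=
  star fun k => gRoot n lam0 k (z0 n lam0) ^ j

/-- The matrix `Φ̂_s` whose column `j` is `Φ₀^(s(n+1)+j)(0) / (s(n+1)+j)! · R_j`. -/
def PhiHat (n : ℕ) (lam0 : ℂ) (x t : ℝ) (s : ℕ) : Matrix (Fin (n + 1)) (Fin (n + 1)) ℂ :=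
  Matrix.of fun i j =>
    ((Matrix.of fun i' k => iteratedDeriv (s * (n + 1) + j) (fun ε => Phi0 n lam0 x t ε i' k) 0 /
      ((s * (n + 1) + j).factorial : ℂ)) *ᵥ RVec n lam0 j) i

/-- `Φ̃_k = ∑_{s=0}^k Φ̂_s γ_{k-s} β`, where the `γ_k` are constant square matrices and `β` is a
constant vector. -/
def PhiTilde (n : ℕ) (lam0 : ℂ) (γ : ℕ → Matrix (Fin (n + 1)) (Fin (n + 1)) ℂ)
    (β : Fin (n + 1) → ℂ) (x t : ℝ) (k : ℕ) : Fin (n + 1) → ℂ :=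
  ∑ s ∈ Finset.range (k + 1), (PhiHat n lam0 x t s * γ (k - s)) *ᵥ β

/-- The `N × N` matrix with entries
`1/(i(n+1)ζ) ∑_{s≤m} ∑_{l≤k} (-1/2)^{s+l} C(s+l,l) Φ̃_{m-s}^† Φ̃_{k-l}`. -/
def MMat (n N : ℕ) (lam0 : ℂ) (γ : ℕ → Matrix (Fin (n + 1)) (Fin (n + 1)) ℂ)
    (β : Fin (n + 1) → ℂ) (x t : ℝ) : Matrix (Fin N) (Fin N) ℂ :=
  Matrix.of fun m k => 1 / (I * ((n : ℂ) + 1) * (zeta n lam0 : ℂ)) *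
    ∑ s ∈ Finset.range ((m : ℕ) + 1), ∑ l ∈ Finset.range ((k : ℕ) + 1),
      (-1 / 2 : ℂ) ^ (s + l) * ((s + l).choose l : ℂ) *
        (star (PhiTilde n lam0 γ β x t (m - s)) ⬝ᵥ PhiTilde n lam0 γ β x t (k - l))

/-- The matrix `Y = (Φ̃_0, …, Φ̃_{N-1})`; its rows are `Y_1, …, Y_{n+1}`. -/
def YMat (n N : ℕ) (lam0 : ℂ) (γ : ℕ → Matrix (Fin (n + 1)) (Fin (n + 1)) ℂ)
    (β : Fin (n + 1) → ℂ) (x t : ℝ) : Matrix (Fin (n + 1)) (Fin N) ℂ :=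
  Matrix.of fun i k => PhiTilde n lam0 γ β x t k i

/-- The `N`-th order vector rational rogue wave
`q_j^bg + 2 det [[M, Y_1^†], [Y_{j+1}, 0]] / det M`. -/
def qN (n N : ℕ) (lam0 : ℂ) (γ : ℕ → Matrix (Fin (n + 1)) (Fin (n + 1)) ℂ)
    (β : Fin (n + 1) → ℂ) (x t : ℝ) (j : Fin n) : ℂ :=
  qbg n lam0 x t j + 2 * (Matrix.fromBlocks (MMat n N lam0 γ β x t)
      (Matrix.replicateCol Unit (star (YMat n N lam0 γ β x t 0)))
      (Matrix.replicateRow Unit (YMat n N lam0 γ β x t j.succ)) 0).det /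
    (MMat n N lam0 γ β x t).det

/-! ### Amplitudes -/

/-- `‖q^[N](x,t)‖₁ / ‖a‖₁`. -/
def avgRatio (n N : ℕ) (lam0 : ℂ) (γ : ℕ → Matrix (Fin (n + 1)) (Fin (n + 1)) ℂ)
    (β : Fin (n + 1) → ℂ) (x t : ℝ) : ℝ :=
  (∑ j, ‖qN n N lam0 γ β x t j‖) / ∑ j, |amp n lam0 j|

/-- `|q_j^[N](x,t) / a_j|`. -/
def compRatio (n N : ℕ) (lam0 : ℂ) (γ : ℕ → Matrix (Fin (n + 1)) (Fin (n + 1)) ℂ)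
    (β : Fin (n + 1) → ℂ) (x t : ℝ) (j : Fin n) : ℝ :=
  ‖qN n N lam0 γ β x t j / (amp n lam0 j : ℂ)‖

/-- All values of `‖q^[N]‖₁ / ‖a‖₁`, over all parameters `γ_0, …, γ_{N-1}`, `β` and all points
`(x,t)` at which the quotient of determinants is defined. Its maximum is `GA[N]`. -/
def avgRatioSet (n N : ℕ) (lam0 : ℂ) : Set ℝ :=
  {r | ∃ (γ : ℕ → Matrix (Fin (n + 1)) (Fin (n + 1)) ℂ) (β : Fin (n + 1) → ℂ) (x t : ℝ),
    (MMat n N lam0 γ β x t).det ≠ 0 ∧ r = avgRatio n N lam0 γ β x t}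

/-- All values of `|q_j^[N] / a_j|`, over the same parameters. Its maximum is `A_j[N]`. -/
def compRatioSet (n N : ℕ) (lam0 : ℂ) (j : Fin n) : Set ℝ :=
  {r | ∃ (γ : ℕ → Matrix (Fin (n + 1)) (Fin (n + 1)) ℂ) (β : Fin (n + 1) → ℂ) (x t : ℝ),
    (MMat n N lam0 γ β x t).det ≠ 0 ∧ r = compRatio n N lam0 γ β x t j}

/-- `η = (√n, i, …, i)ᵀ`. -/
def eta (n : ℕ) : Fin (n + 1) → ℂ :=
  Fin.cons ((Real.sqrt n : ℝ) : ℂ) fun _ => I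

/-- `η_j = (1, 0, …, 0, i, 0, …, 0)ᵀ`, with `i` in the place of the `j`-th component. -/
def etaComp (n : ℕ) (j : Fin n) : Fin (n + 1) → ℂ :=
  Fin.cons 1 (Pi.single j I)

end VectorRogue

end

open VectorRogue

/-!
Two independent facts carry the result.

*Amplitudes.* Up to the scalar `1 / (i (n+1) ζ)`, the matrix `M` is a weighted Gram matrix `P` of
the columns of `Y = (Φ̃_0, …, Φ̃_{N-1})`. Its weights are the coefficients of `1 / (1 + (u+v)/2)`,
so `P` solves the Lyapunov equation `P + (Sᵀ P + P S) / 2 = Y† Y` with the nilpotent shift `S`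
(`lyapunovGram_add_shift`), and Vandermonde's identity shows that `P` is positive semidefinite
(`lyapunovGram_posSemidef`). Where `det P ≠ 0`, the matrix `K = Y P⁻¹ Y†` is therefore positive
semidefinite, and multiplying the Lyapunov equation by `P⁻¹` gives `tr K = N` (`trace_kernelMat`).
A Schur complement turns the quotient of determinants into
`q_j = q_j^bg - 2 i (n+1) ζ K_{j+1,1}` (`qN_eq`). The bounds `|K_{j+1,1}| ≤ N/2` and
`∑_j |K_{j+1,1}| ≤ √n N/2` follow from the `2 × 2` principal minors of `K`, the trace, and the
inequality of Cauchy and Schwarz; they need nothing about the vectors `Φ̃_k`. If all columns of `Y`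
but the first vanish, then `K = N β β† / ‖β‖²`, and `η`, `η_j` are the vectors for which the bounds
are equalities and the correction has the phase of `a_j`.

*Invertibility of `Φ̂₀(0,0)`.* The branches satisfy `μ_k(ε) = μ_0(ε g_k/g_0)`, so the columns of
`Φ̂₀(0,0)` are nonzero multiples of the first `n + 1` Taylor coefficients of `h ∘ μ_0`
(`PhiHat_zero_origin`). If a row vector annihilates them, the corresponding combination of
`1, a_1/(z+b_1), …, a_n/(z+b_n)` vanishes to order `n + 1` at `z₀`. Its numerator has degree at most
`n`, hence is zero, and the row vector is zero because the `b_j` are distinct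
(`PhiHat_zero_isUnit`).
-/

namespace VectorRogue

open Complex Matrix

/-! ### Trigonometry of the background -/

theorem omega_mem_Ioo (n : ℕ) (j : Fin n) : omega n j ∈ Set.Ioo 0 Real.pi := by
  have hn : (0 : ℝ) < n + 1 := by positivity
  have hj : (j : ℝ) + 1 < n + 1 := by exact_mod_cast Nat.succ_lt_succ j.2
  have := Real.pi_pos
  refine ⟨by unfold omega; positivity, ?_⟩
  rw [omega, div_lt_iff₀ hn, mul_comm Real.pi]
  exact mul_lt_mul_of_pos_right hj this

theorem sin_omega_pos (n : ℕ) (j : Fin n) : 0 < Real.sin (omega n j) :=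
  Real.sin_pos_of_mem_Ioo (omega_mem_Ioo n j)

theorem omega_injective (n : ℕ) : Function.Injective (omega n) := by
  intro i j h
  have hn : (n : ℝ) + 1 ≠ 0 := by positivity
  rw [omega, omega, div_left_inj' hn, mul_left_inj' Real.pi_ne_zero, add_left_inj] at h
  exact Fin.ext (by exact_mod_cast h)

theorem zeta_ne_zero (n : ℕ) {lam0 : ℂ} (h : lam0.im ≠ 0) : zeta n lam0 ≠ 0 :=
  div_ne_zero (mul_ne_zero two_ne_zero h) (by positivity)

theorem amp_ne_zero (n : ℕ) {lam0 : ℂ} (h : lam0.im ≠ 0) (j : Fin n) : amp n lam0 j ≠ 0 :=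
  div_ne_zero (zeta_ne_zero n h) (sin_omega_pos n j).ne'

theorem cot_injOn : Set.InjOn Real.cot (Set.Ioo 0 Real.pi) := by
  intro x hx y hy h
  have hsx := (Real.sin_pos_of_mem_Ioo hx).ne'
  have hsy := (Real.sin_pos_of_mem_Ioo hy).ne'
  rw [Real.cot_eq_cos_div_sin, Real.cot_eq_cos_div_sin, div_eq_div_iff hsx hsy] at h
  have h0 : Real.sin (x - y) = 0 := by rw [Real.sin_sub]; linarith
  rw [Real.sin_eq_zero_iff_of_lt_of_lt (by linarith [hx.1, hy.2]) (by linarith [hx.2, hy.1])] at h0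
  linarith

theorem waveNum_injective (n : ℕ) {lam0 : ℂ} (h : lam0.im ≠ 0) :
    Function.Injective (waveNum n lam0) := by
  intro i j hij
  have := mul_left_cancel₀ (zeta_ne_zero n h) (sub_left_injective hij)
  exact omega_injective n (cot_injOn (omega_mem_Ioo n i) (omega_mem_Ioo n j) this)

theorem z0_add_waveNum_ne_zero (n : ℕ) {lam0 : ℂ} (h : lam0.im ≠ 0) (j : Fin n) :
    z0 n lam0 + (waveNum n lam0 j : ℂ) ≠ 0 := by
  intro hs
  have := congrArg Complex.im hs
  exact zeta_ne_zero n h (by simpa [z0] using this)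

/-! ### The branches `μ_k` -/

/-- Neither regularity of `f` nor `c ≠ 0` is needed, because `deriv_comp_mul_left` needs neither. -/
theorem iteratedDeriv_comp_mul_left (f : ℂ → ℂ) (c : ℂ) (m : ℕ) :
    iteratedDeriv m (fun x => f (c * x)) = fun x => c ^ m * iteratedDeriv m f (c * x) := by
  induction m with
  | zero => simp
  | succ m ih =>
    funext x
    rw [iteratedDeriv_succ, ih, deriv_const_mul_field]
    rw [deriv_comp_mul_left c (iteratedDeriv m f) x, iteratedDeriv_succ, smul_eq_mul, pow_succ,
      mul_assoc]

theorem analyticAt_eps (n : ℕ) {lam0 : ℂ} (h : lam0.im ≠ 0) (k : Fin (n + 1)) :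
    AnalyticAt ℂ (fun z => (z - z0 n lam0) / gRoot n lam0 k z) (z0 n lam0) := by
  have hf := fPoly_z0_ne_zero n lam0 h
  have hF : AnalyticAt ℂ (fPoly n lam0) (z0 n lam0) := by
    have : Differentiable ℂ (fPoly n lam0) := by
      unfold fPoly
      fun_prop
    exact this.analyticAt _
  have hG : AnalyticAt ℂ (gRoot n lam0 k) (z0 n lam0) :=
    analyticAt_const.mul (((hF.div analyticAt_const hf)).cpow analyticAt_const
      (by simp [div_self hf]))
  exact (analyticAt_id.sub analyticAt_const).div hG (gRoot_z0_ne_zero n lam0 h k)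

theorem mu_zero (n : ℕ) {lam0 : ℂ} (h : lam0.im ≠ 0) (k : Fin (n + 1)) :
    mu n lam0 k 0 = z0 n lam0 := by
  have := HasStrictFDerivAt.localInverse_apply_image
    ((hasStrictDerivAt_eps n lam0 h k).hasStrictFDerivAt_equiv
      (inv_ne_zero (gRoot_z0_ne_zero n lam0 h k)))
  rw [mu, dif_pos h]
  simpa using this

theorem mu_hasStrictDerivAt (n : ℕ) {lam0 : ℂ} (h : lam0.im ≠ 0) (k : Fin (n + 1)) :
    HasStrictDerivAt (mu n lam0 k) (gRoot n lam0 k (z0 n lam0)) 0 := by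
  have := (hasStrictDerivAt_eps n lam0 h k).to_localInverse
    (inv_ne_zero (gRoot_z0_ne_zero n lam0 h k))
  rw [mu, dif_pos h]
  simpa using this

theorem mu_analyticAt (n : ℕ) {lam0 : ℂ} (h : lam0.im ≠ 0) (k : Fin (n + 1)) :
    AnalyticAt ℂ (mu n lam0 k) 0 := by
  have hd := hasStrictDerivAt_eps n lam0 h k
  have hd' : deriv (fun z => (z - z0 n lam0) / gRoot n lam0 k z) (z0 n lam0) ≠ 0 := by
    rw [hd.hasDerivAt.deriv]
    exact inv_ne_zero (gRoot_z0_ne_zero n lam0 h k)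
  have := (analyticAt_eps n h k).analyticAt_localInverse hd'
  have e : mu n lam0 k = (analyticAt_eps n h k).hasStrictDerivAt.localInverse _ _ _ hd' := by
    rw [mu, dif_pos h]
    congr 1
    exact hd.hasDerivAt.deriv.symm
  rw [e]
  simpa using this

theorem mu_right_inverse (n : ℕ) {lam0 : ℂ} (h : lam0.im ≠ 0) (k : Fin (n + 1)) :
    ∀ᶠ ε in nhds 0, (mu n lam0 k ε - z0 n lam0) / gRoot n lam0 k (mu n lam0 k ε) = ε := by
  have := (hasStrictDerivAt_eps n lam0 h k).eventually_right_inverse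
    (inv_ne_zero (gRoot_z0_ne_zero n lam0 h k))
  rw [mu, dif_pos h]
  simpa using this

theorem mu_left_inverse (n : ℕ) {lam0 : ℂ} (h : lam0.im ≠ 0) (k : Fin (n + 1)) :
    ∀ᶠ z in nhds (z0 n lam0), mu n lam0 k ((z - z0 n lam0) / gRoot n lam0 k z) = z := by
  have := (hasStrictDerivAt_eps n lam0 h k).eventually_left_inverse
    (inv_ne_zero (gRoot_z0_ne_zero n lam0 h k))
  rw [mu, dif_pos h]
  simpa using this

/-- The branches differ by a rotation of the parameter: `μ_k(ε) = μ_0(ε g_k(z₀) / g_0(z₀))`. -/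
theorem mu_eq_mu_zero_rotate (n : ℕ) {lam0 : ℂ} (h : lam0.im ≠ 0) (k : Fin (n + 1)) :
    ∀ᶠ ε in nhds 0,
      mu n lam0 k ε = mu n lam0 0 (gRoot0 n lam0 k / gRoot0 n lam0 0 * ε) := by
  have hk : gRoot0 n lam0 k ≠ 0 := gRoot_z0 n lam0 h k ▸ gRoot_z0_ne_zero n lam0 h k
  have h0 : gRoot0 n lam0 0 ≠ 0 := gRoot_z0 n lam0 h 0 ▸ gRoot_z0_ne_zero n lam0 h 0
  have hc : Filter.Tendsto (mu n lam0 k) (nhds 0) (nhds (z0 n lam0)) := by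
    have := (mu_analyticAt n h k).continuousAt.tendsto
    rwa [mu_zero n h] at this
  -- Both branches invert the same function up to the constant factor `g_k(z₀) / g_0(z₀)`.
  filter_upwards [mu_right_inverse n h k, hc.eventually (mu_left_inverse n h 0)] with ε h1 h2
  rw [← h2]
  congr 1
  conv_rhs => rw [← h1]
  simp only [gRoot]
  field_simp

/-! ### Invertibility of `Φ̂₀` at the origin -/

/-- The vector `h(z)` at the origin, `(1, a_1/(z+b_1), …, a_n/(z+b_n))`. -/
noncomputable def hOrigin (n : ℕ) (lam0 z : ℂ) : Fin (n + 1) → ℂ :=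
  Fin.cons (1 : ℂ) fun j : Fin n => (amp n lam0 j : ℂ) / (z + (waveNum n lam0 j : ℂ))

theorem hVec_origin (n : ℕ) (lam0 l z : ℂ) : hVec n lam0 0 0 l z = hOrigin n lam0 z := by
  funext i
  simp [hVec, hOrigin, phase]

theorem hOrigin_analyticAt (n : ℕ) {lam0 : ℂ} (h : lam0.im ≠ 0) (i : Fin (n + 1)) :
    AnalyticAt ℂ (fun z => hOrigin n lam0 z i) (z0 n lam0) := by
  refine Fin.cases ?_ (fun j => ?_) i
  · simpa [hOrigin] using analyticAt_const
  · simp only [hOrigin, Fin.cons_succ]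
    exact analyticAt_const.div (analyticAt_id.add analyticAt_const) (z0_add_waveNum_ne_zero n h j)

theorem iteratedDeriv_Phi0_origin (n : ℕ) {lam0 : ℂ} (h : lam0.im ≠ 0) (m : ℕ)
    (i k : Fin (n + 1)) :
    iteratedDeriv m (fun ε => Phi0 n lam0 0 0 ε i k) 0 =
      (gRoot0 n lam0 k / gRoot0 n lam0 0) ^ m *
        iteratedDeriv m (fun ε => hOrigin n lam0 (mu n lam0 0 ε) i) 0 := by
  have e : (fun ε => Phi0 n lam0 0 0 ε i k) =ᶠ[nhds 0] fun ε =>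
      (fun w => hOrigin n lam0 (mu n lam0 0 w) i) (gRoot0 n lam0 k / gRoot0 n lam0 0 * ε) := by
    filter_upwards [mu_eq_mu_zero_rotate n h k] with ε hε
    simp only [Phi0, Matrix.of_apply, hVec_origin, hε]
  rw [e.iteratedDeriv_eq, iteratedDeriv_comp_mul_left (fun w => hOrigin n lam0 (mu n lam0 0 w) i)]
  simp

/-- Weighting with `R_j` adds the contributions of the `n + 1` branches without cancellation, so
the columns of `Φ̂₀` at the origin are nonzero multiples of the Taylor coefficients of the single
curve `h ∘ μ_0`. -/
theorem PhiHat_zero_origin (n : ℕ) {lam0 : ℂ} (h : lam0.im ≠ 0) (j : Fin (n + 1)) :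
    ∃ C : ℂ, C ≠ 0 ∧ ∀ i, PhiHat n lam0 0 0 0 i j =
      C * iteratedDeriv j (fun ε => hOrigin n lam0 (mu n lam0 0 ε) i) 0 := by
  have hg : ∀ k, gRoot0 n lam0 k ≠ 0 := fun k => gRoot_z0 n lam0 h k ▸ gRoot_z0_ne_zero n lam0 h k
  refine ⟨((∑ k, ‖gRoot0 n lam0 k‖ ^ (2 * (j : ℕ)) : ℝ) : ℂ) /
    (gRoot0 n lam0 0 ^ (j : ℕ) * ((j : ℕ).factorial : ℂ)), ?_, fun i => ?_⟩
  · refine div_ne_zero (Complex.ofReal_ne_zero.2 (Finset.sum_pos (fun k _ => ?_) ⟨0, by simp⟩).ne')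
      (mul_ne_zero (pow_ne_zero _ (hg 0)) (Nat.cast_ne_zero.2 (Nat.factorial_ne_zero _)))
    exact pow_pos (norm_pos_iff.2 (hg k)) _
  · have hf : ((j : ℕ).factorial : ℂ) ≠ 0 := Nat.cast_ne_zero.2 (Nat.factorial_ne_zero _)
    have hg0 := hg 0
    simp only [PhiHat, Matrix.of_apply, Matrix.mulVec, dotProduct, RVec, zero_mul, zero_add,
      iteratedDeriv_Phi0_origin n h, Pi.star_apply, gRoot_z0 n lam0 h]
    push_cast
    rw [Finset.sum_div, Finset.sum_mul]
    refine Finset.sum_congr rfl fun k _ => ?_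
    -- `|g_k|^(2j) = g_k^j (conj g_k)^j`: the second factor comes from `R_j`, the first from `μ_k`.
    rw [pow_mul (‖_‖ : ℂ), ← Complex.mul_conj', mul_pow, star_pow, Complex.star_def, div_pow]
    field_simp

/-- A polynomial vanishes if its order of vanishing at a point exceeds its degree. -/
theorem polynomial_eq_zero_of_le_analyticOrderAt {p : Polynomial ℂ} {m : ℕ} {z : ℂ}
    (hp : p.natDegree < m) (h : m ≤ analyticOrderAt (fun w => p.eval w) z) : p = 0 := by
  by_contra hne
  obtain ⟨q, hq, hdvd⟩ := Polynomial.exists_eq_pow_rootMultiplicity_mul_and_not_dvd p hne z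
  have hqz : q.eval z ≠ 0 := fun h0 => hdvd (Polynomial.dvd_iff_isRoot.2 h0)
  have han : ∀ r : Polynomial ℂ, AnalyticAt ℂ (fun w => r.eval w) z := fun r =>
    r.differentiable.analyticAt z
  have hord : analyticOrderAt (fun w => p.eval w) z = p.rootMultiplicity z := by
    refine ((han p).analyticOrderAt_eq_natCast).2 ⟨_, han q, hqz, .of_forall fun w => ?_⟩
    conv_lhs => rw [hq]
    simp
  rw [hord, Nat.cast_le] at h
  have := (Polynomial.card_roots' p).trans_lt hp
  rw [← Polynomial.count_roots] at h
  exact absurd (h.trans (Multiset.count_le_card _ _)) (not_le.2 this)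

/-- The numerator of `∑_i v_i h_i(z)` over the common denominator `∏_s (z + b_s)`. -/
noncomputable def numerator (n : ℕ) (lam0 : ℂ) (v : Fin (n + 1) → ℂ) : Polynomial ℂ :=
  Polynomial.C (v 0) * ∏ s : Fin n, (Polynomial.X + Polynomial.C (waveNum n lam0 s : ℂ)) +
    ∑ j : Fin n, Polynomial.C (v j.succ * amp n lam0 j) *
      ∏ s ∈ Finset.univ.erase j, (Polynomial.X + Polynomial.C (waveNum n lam0 s : ℂ))

theorem numerator_natDegree_le (n : ℕ) (lam0 : ℂ) (v : Fin (n + 1) → ℂ) :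
    (numerator n lam0 v).natDegree ≤ n := by
  have hprod : ∀ S : Finset (Fin n),
      (∏ s ∈ S, (Polynomial.X + Polynomial.C (waveNum n lam0 s : ℂ))).natDegree ≤ n := by
    intro S
    refine (Polynomial.natDegree_prod_le _ _).trans ?_
    simp only [Polynomial.natDegree_X_add_C, Finset.sum_const, smul_eq_mul, mul_one]
    exact (Finset.card_le_univ S).trans (by simp)
  refine Polynomial.natDegree_add_le_of_degree_le ?_ ?_
  · exact (Polynomial.natDegree_C_mul_le _ _).trans (hprod _)
  · exact Polynomial.natDegree_sum_le_of_forall_le _ _ fun j _ =>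
      (Polynomial.natDegree_C_mul_le _ _).trans (hprod _)

theorem numerator_eval (n : ℕ) (lam0 : ℂ) (v : Fin (n + 1) → ℂ) {z : ℂ}
    (hz : ∀ s, z + (waveNum n lam0 s : ℂ) ≠ 0) :
    (numerator n lam0 v).eval z =
      (∏ s : Fin n, (z + (waveNum n lam0 s : ℂ))) * ∑ i, v i * hOrigin n lam0 z i := by
  rw [numerator, Fin.sum_univ_succ, mul_add]
  simp only [Polynomial.eval_add, Polynomial.eval_mul, Polynomial.eval_C, Polynomial.eval_prod,
    Polynomial.eval_X, Polynomial.eval_finsetSum, hOrigin, Fin.cons_zero, Fin.cons_succ,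
    Finset.mul_sum]
  congr 1
  · ring
  · refine Finset.sum_congr rfl fun j _ => ?_
    rw [← Finset.mul_prod_erase _ _ (Finset.mem_univ j)]
    have := hz j
    field_simp

theorem numerator_injective (n : ℕ) {lam0 : ℂ} (h : lam0.im ≠ 0) {v : Fin (n + 1) → ℂ}
    (hv : numerator n lam0 v = 0) : v = 0 := by
  have hsucc : ∀ j : Fin n, v j.succ = 0 := by
    intro j
    -- At `z = -b_j` every summand except the `j`-th contains the factor `z + b_j`.
    have he := congrArg (Polynomial.eval (-(waveNum n lam0 j : ℂ))) hv
    simp only [numerator, Polynomial.eval_add, Polynomial.eval_mul, Polynomial.eval_C,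
      Polynomial.eval_prod, Polynomial.eval_X, Polynomial.eval_finsetSum,
      Polynomial.eval_zero] at he
    rw [Finset.prod_eq_zero (Finset.mem_univ j) (by simp), Finset.sum_eq_single j, mul_zero,
      zero_add] at he
    · refine (mul_eq_zero.1 ((mul_eq_zero.1 he).resolve_right ?_)).resolve_right ?_
      · refine Finset.prod_ne_zero_iff.2 fun s hs h0 => (Finset.mem_erase.1 hs).1 ?_
        refine waveNum_injective n h ?_
        exact_mod_cast (neg_add_eq_zero.1 h0).symm
      · exact_mod_cast amp_ne_zero n h j
    · intro i _ hij
      rw [Finset.prod_eq_zero (Finset.mem_erase.2 ⟨hij.symm, Finset.mem_univ j⟩) (by simp),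
        mul_zero]
    · simp
  have h0 : v 0 = 0 := by
    simp only [numerator, hsucc, zero_mul, Polynomial.C_0, Finset.sum_const_zero, add_zero] at hv
    refine Polynomial.C_eq_zero.1 ((mul_eq_zero.1 hv).resolve_right ?_)
    exact Finset.prod_ne_zero_iff.2 fun s _ => Polynomial.X_add_C_ne_zero _
  funext i
  exact Fin.cases h0 hsucc i

/-- A row vector annihilating `Φ̂₀` gives a combination of the `h_i` that vanishes to order `n + 1`
at `z₀`; its numerator has degree at most `n`, so it is zero. -/
theorem PhiHat_zero_isUnit (n : ℕ) {lam0 : ℂ} (h : lam0.im ≠ 0) :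
    IsUnit (PhiHat n lam0 0 0 0) := by
  rw [Matrix.isUnit_iff_isUnit_det, isUnit_iff_ne_zero]
  intro hdet
  obtain ⟨v, hv0, hv⟩ := Matrix.exists_vecMul_eq_zero_iff.2 hdet
  refine hv0 (numerator_injective n h ?_)
  let H : ℂ → ℂ := fun z => ∑ i, v i * hOrigin n lam0 z i
  have hH : AnalyticAt ℂ H (z0 n lam0) :=
    Finset.univ.analyticAt_fun_sum fun i _ => analyticAt_const.mul (hOrigin_analyticAt n h i)
  have hmu := mu_analyticAt n h 0
  have hcomp : ∀ {f : ℂ → ℂ}, AnalyticAt ℂ f (z0 n lam0) →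
      AnalyticAt ℂ (fun ε => f (mu n lam0 0 ε)) 0 := fun hf =>
    AnalyticAt.fun_comp (by rwa [mu_zero n h]) hmu
  have hder : ∀ m < n + 1, iteratedDeriv m (fun ε => H (mu n lam0 0 ε)) 0 = 0 := by
    intro m hm
    obtain ⟨C, hC, hcol⟩ := PhiHat_zero_origin n h ⟨m, hm⟩
    have hvm := congrFun hv ⟨m, hm⟩
    simp only [Matrix.vecMul, dotProduct, hcol, Pi.zero_apply] at hvm
    refine (mul_eq_zero.1 (?_ : C * _ = 0)).resolve_left hC
    refine Eq.trans ?_ hvm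
    simp only [H]
    rw [iteratedDeriv_fun_sum (f := fun i ε => v i * hOrigin n lam0 (mu n lam0 0 ε) i) fun i _ =>
      (analyticAt_const.mul (hcomp (hOrigin_analyticAt n h i))).contDiffAt, Finset.mul_sum]
    refine Finset.sum_congr rfl fun i _ => ?_
    rw [iteratedDeriv_const_mul_field]
    ring
  have hord : ((n + 1 : ℕ) : ℕ∞) ≤ analyticOrderAt H (z0 n lam0) := by
    have h1 := (natCast_le_analyticOrderAt_iff_iteratedDeriv_eq_zero (hcomp hH)).2 hder
    have h2 := analyticOrderAt_comp_of_deriv_ne_zero (f := H) hmu (by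
      rw [(mu_hasStrictDerivAt n h 0).hasDerivAt.deriv]
      exact gRoot_z0_ne_zero n lam0 h 0)
    rw [mu_zero n h] at h2
    rwa [← h2]
  refine polynomial_eq_zero_of_le_analyticOrderAt (m := n + 1) (z := z0 n lam0)
    (Nat.lt_succ_of_le (numerator_natDegree_le n lam0 v)) ?_
  have hden : AnalyticAt ℂ (fun z => ∏ s : Fin n, (z + (waveNum n lam0 s : ℂ))) (z0 n lam0) := by
    have : Differentiable ℂ fun z => ∏ s : Fin n, (z + (waveNum n lam0 s : ℂ)) := by fun_prop
    exact this.analyticAt _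
  have heq : (fun z => (numerator n lam0 v).eval z) =ᶠ[nhds (z0 n lam0)]
      (fun z => ∏ s : Fin n, (z + (waveNum n lam0 s : ℂ))) * H := by
    have : ∀ s : Fin n, ∀ᶠ z in nhds (z0 n lam0), z + (waveNum n lam0 s : ℂ) ≠ 0 := fun s =>
      (continuous_id.add continuous_const).continuousAt.eventually_ne
        (z0_add_waveNum_ne_zero n h s)
    filter_upwards [Filter.eventually_all.2 this] with z hz
    exact numerator_eval n lam0 v hz
  rw [analyticOrderAt_congr heq, analyticOrderAt_mul hden hH]
  exact hord.trans le_add_self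

/-! ### A Lyapunov equation for a weighted Gram matrix -/

/-- The coefficients `(-1/2)^(s+l) C(s+l,l)` of `u^s v^l` in `1 / (1 + (u + v)/2)`. -/
noncomputable def lyapunovWeight (s l : ℕ) : ℂ := (-1 / 2 : ℂ) ^ (s + l) * ((s + l).choose l : ℂ)

/-- The weighted Gram matrix `∑_{s ≤ m} ∑_{l ≤ k} (-1/2)^(s+l) C(s+l,l) y_{m-s}^† y_{k-l}` of a
sequence of vectors `y`. -/
noncomputable def lyapunovGram {ι : Type*} [Fintype ι] (N : ℕ) (y : ℕ → ι → ℂ) :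
    Matrix (Fin N) (Fin N) ℂ :=
  Matrix.of fun m k => ∑ s ∈ Finset.range ((m : ℕ) + 1), ∑ l ∈ Finset.range ((k : ℕ) + 1),
    lyapunovWeight s l * (star (y (m - s)) ⬝ᵥ y (k - l))

/-- The matrix with columns `y 0, …, y (N - 1)`. -/
noncomputable def colMat {ι : Type*} (N : ℕ) (y : ℕ → ι → ℂ) : Matrix ι (Fin N) ℂ :=
  Matrix.of fun i k => y k i

/-- The nilpotent matrix with ones on the first superdiagonal. -/
noncomputable def superShift (N : ℕ) : Matrix (Fin N) (Fin N) ℂ :=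
  Matrix.of fun i k => if (i : ℕ) + 1 = k then 1 else 0

theorem trace_superShift (N : ℕ) : (superShift N).trace = 0 := by
  simp [superShift, Matrix.trace]

theorem mul_superShift_apply {N : ℕ} (A : ℕ → ℕ → ℂ) (m k : Fin N) :
    ((Matrix.of fun i j : Fin N => A i j) * superShift N : Matrix _ _ ℂ) m k =
      if (k : ℕ) = 0 then 0 else A m (k - 1) := by
  rw [Matrix.mul_apply]
  simp only [superShift, Matrix.of_apply, mul_ite, mul_one, mul_zero]
  split_ifs with h
  · exact Finset.sum_eq_zero fun i _ => if_neg (by omega)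
  · rw [Finset.sum_eq_single ⟨k - 1, by omega⟩]
    · exact if_pos (show (k : ℕ) - 1 + 1 = k by omega)
    · intro b _ hb
      refine if_neg fun h' => hb (Fin.ext ?_)
      show (b : ℕ) = k - 1
      omega
    · simp

theorem superShift_transpose_mul_apply {N : ℕ} (A : ℕ → ℕ → ℂ) (m k : Fin N) :
    ((superShift N)ᵀ * (Matrix.of fun i j : Fin N => A i j) : Matrix _ _ ℂ) m k =
      if (m : ℕ) = 0 then 0 else A (m - 1) k := by
  have := mul_superShift_apply (fun i j => A j i) k m
  rw [← this, ← Matrix.transpose_apply (M := _ * superShift N), Matrix.transpose_mul]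
  rfl

/-- Division of the generating function by `1 + (u + v)/2`: Pascal's rule makes all
coefficients except the first cancel. -/
theorem lyapunovWeight_rec (s l : ℕ) :
    lyapunovWeight s l + 1 / 2 * ((if s = 0 then 0 else lyapunovWeight (s - 1) l) +
      (if l = 0 then 0 else lyapunovWeight s (l - 1))) = if s = 0 ∧ l = 0 then 1 else 0 := by
  rcases s with _ | s <;> rcases l with _ | l
  · simp [lyapunovWeight]
  · simp [lyapunovWeight, pow_succ]; ring
  · simp [lyapunovWeight, pow_succ]; ring
  · have h : ((s + 1 + (l + 1)).choose (l + 1) : ℂ) =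
        ((s + (l + 1)).choose (l + 1) : ℂ) + ((s + 1 + l).choose l : ℂ) := by
      rw [show s + 1 + (l + 1) = s + l + 1 + 1 by ring, Nat.choose_succ_succ,
        show s + (l + 1) = s + l + 1 by ring, show s + 1 + l = s + l + 1 by ring]
      push_cast
      ring
    simp only [lyapunovWeight, h, Nat.add_sub_cancel, Nat.succ_ne_zero, if_false, false_and]
    ring

/-- A convolution with shifted weights is the shifted convolution. -/
theorem sum_range_shift (w : ℕ → ℂ) (g : ℕ → ℂ) (m : ℕ) :
    ∑ s ∈ Finset.range (m + 1), (if s = 0 then 0 else w (s - 1)) * g (m - s) =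
      if m = 0 then 0 else ∑ s ∈ Finset.range (m - 1 + 1), w s * g (m - 1 - s) := by
  rcases m with _ | m
  · simp
  · rw [Finset.sum_range_succ']
    simp [Nat.add_sub_add_right]

/-- The weighted Gram matrix solves the Lyapunov equation `P + (Sᵀ P + P S) / 2 = Y† Y` with the
nilpotent shift `S`. -/
theorem lyapunovGram_add_shift {ι : Type*} [Fintype ι] (N : ℕ) (y : ℕ → ι → ℂ) :
    lyapunovGram N y + (1 / 2 : ℂ) • ((superShift N)ᵀ * lyapunovGram N y +
      lyapunovGram N y * superShift N) = (colMat N y)ᴴ * colMat N y := by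
  let g : ℕ → ℕ → ℂ := fun a b => star (y a) ⬝ᵥ y b
  let F : ℕ → ℕ → ℂ := fun m k => ∑ s ∈ Finset.range (m + 1), ∑ l ∈ Finset.range (k + 1),
    lyapunovWeight s l * g (m - s) (k - l)
  have hP : lyapunovGram N y = Matrix.of fun i j : Fin N => F i j := rfl
  ext m k
  have h1 : (if (m : ℕ) = 0 then 0 else F (m - 1) k) = ∑ s ∈ Finset.range ((m : ℕ) + 1),
      ∑ l ∈ Finset.range ((k : ℕ) + 1),
        (if s = 0 then 0 else lyapunovWeight (s - 1) l) * g (m - s) (k - l) := by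
    rw [Finset.sum_comm]
    simp_rw [fun l => sum_range_shift (fun s => lyapunovWeight s l) (fun a => g a (k - l)) m]
    split_ifs
    · simp
    · exact Finset.sum_comm
  have h2 : (if (k : ℕ) = 0 then 0 else F m (k - 1)) = ∑ s ∈ Finset.range ((m : ℕ) + 1),
      ∑ l ∈ Finset.range ((k : ℕ) + 1),
        (if l = 0 then 0 else lyapunovWeight s (l - 1)) * g (m - s) (k - l) := by
    simp_rw [fun s => sum_range_shift (fun l => lyapunovWeight s l) (fun b => g (m - s) b) k]
    split_ifs
    · simp
    · rfl
  rw [hP, Matrix.add_apply, Matrix.smul_apply, Matrix.add_apply, mul_superShift_apply,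
    superShift_transpose_mul_apply, h1, h2]
  have h3 : ((colMat N y)ᴴ * colMat N y) m k = g m k := by
    simp [Matrix.mul_apply, colMat, g, dotProduct]
  rw [h3, Matrix.of_apply]
  simp only [F, smul_eq_mul, ← Finset.sum_add_distrib, Finset.mul_sum, ← add_mul, ← mul_assoc,
    lyapunovWeight_rec]
  rw [Finset.sum_eq_single 0, Finset.sum_eq_single 0]
  · simp
  · intro b _ hb
    simp [hb]
  · simp
  · intro b _ hb
    simp [hb]
  · simp

theorem choose_add_eq_sum_mul (s : ℕ) {l N : ℕ} (hl : l < N) :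
    (s + l).choose l = ∑ i : Fin N, s.choose i * l.choose i := by
  rw [Nat.add_choose_eq, Finset.Nat.sum_antidiagonal_eq_sum_range_succ_mk,
    Fin.sum_univ_eq_sum_range (fun i => s.choose i * l.choose i)]
  rw [← Finset.sum_subset (Finset.range_subset_range.2 (Nat.succ_le_of_lt hl))]
  · refine Finset.sum_congr rfl fun i hi => ?_
    rw [Nat.choose_symm (Nat.lt_succ_iff.1 (Finset.mem_range.1 hi))]
  · intro i _ hi
    rw [Nat.choose_eq_zero_of_lt (n := l) (by simpa [Nat.lt_succ_iff] using hi), mul_zero]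

/-- The upper triangular matrix `(-1/2)^k C(k,i)`, whose Gram matrix consists of the weights
`lyapunovWeight`. -/
noncomputable def pascalMat (N : ℕ) : Matrix (Fin N) (Fin N) ℂ :=
  Matrix.of fun i k => (-1 / 2 : ℂ) ^ (k : ℕ) * ((k : ℕ).choose i : ℂ)

theorem lyapunovWeight_eq_sum {N : ℕ} (s : ℕ) {l : ℕ} (hl : l < N) :
    lyapunovWeight s l = ∑ i : Fin N,
      ((-1 / 2 : ℂ) ^ s * (s.choose i : ℂ)) * ((-1 / 2 : ℂ) ^ l * (l.choose i : ℂ)) := by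
  rw [lyapunovWeight, choose_add_eq_sum_mul s hl]
  push_cast
  rw [Finset.mul_sum]
  exact Finset.sum_congr rfl fun i _ => by ring

theorem det_pascalMat_ne_zero (N : ℕ) : (pascalMat N).det ≠ 0 := by
  rw [Matrix.det_of_isUpperTriangular]
  · exact Finset.prod_ne_zero_iff.2 fun i _ => by simp [pascalMat]
  · intro i j hij
    have : (j : ℕ).choose i = 0 := Nat.choose_eq_zero_of_lt hij
    simp [pascalMat, this]

open scoped ComplexOrder

/-- By Vandermonde's identity the weighted Gram matrix is a sum of Gram matrices. -/
theorem lyapunovGram_posSemidef {ι : Type*} [Fintype ι] (N : ℕ) (y : ℕ → ι → ℂ) :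
    (lyapunovGram N y).PosSemidef := by
  let V : Fin N → Matrix ι (Fin N) ℂ := fun i => Matrix.of fun a k =>
    ∑ l ∈ Finset.range ((k : ℕ) + 1), ((-1 / 2 : ℂ) ^ l * (l.choose i : ℂ)) * y (k - l) a
  have h : lyapunovGram N y = ∑ i, (V i)ᴴ * V i := by
    ext m k
    rw [Matrix.sum_apply]
    simp only [Matrix.mul_apply, Matrix.conjTranspose_apply, V, Matrix.of_apply, star_sum,
      Finset.sum_mul_sum]
    rw [lyapunovGram, Matrix.of_apply]
    symm
    rw [Finset.sum_congr rfl fun (i : Fin N) _ => Finset.sum_comm, Finset.sum_comm]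
    refine Finset.sum_congr rfl fun s _ => ?_
    rw [Finset.sum_congr rfl fun (i : Fin N) _ => Finset.sum_comm, Finset.sum_comm]
    refine Finset.sum_congr rfl fun l hl => ?_
    rw [lyapunovWeight_eq_sum s (N := N) (by have := Finset.mem_range.1 hl; omega), dotProduct,
      Finset.sum_mul_sum]
    refine Finset.sum_congr rfl fun i _ => Finset.sum_congr rfl fun a _ => ?_
    simp only [Pi.star_apply, star_mul', star_pow, star_natCast, star_div₀, star_neg, star_one,
      star_ofNat]
    ring
  rw [h]
  exact Matrix.posSemidef_sum _ fun i _ => Matrix.posSemidef_conjTranspose_mul_self _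

/-- The matrix `K = Y P⁻¹ Y†`, with `P` the weighted Gram matrix of the columns of `Y`. It is zero
where `P` is singular. -/
noncomputable def kernelMat {ι : Type*} [Fintype ι] (N : ℕ) (y : ℕ → ι → ℂ) : Matrix ι ι ℂ :=
  colMat N y * (lyapunovGram N y)⁻¹ * (colMat N y)ᴴ

theorem kernelMat_posSemidef {ι : Type*} [Fintype ι] (N : ℕ) (y : ℕ → ι → ℂ) :
    (kernelMat N y).PosSemidef :=
  (lyapunovGram_posSemidef N y).inv.mul_mul_conjTranspose_same _

/-- The trace of `K` is the number of columns: multiply the Lyapunov equation by `P⁻¹` and use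
that the shift has trace zero. -/
theorem trace_kernelMat {ι : Type*} [Fintype ι] (N : ℕ) (y : ℕ → ι → ℂ)
    (h : (lyapunovGram N y).det ≠ 0) : (kernelMat N y).trace = N := by
  have hu : IsUnit (lyapunovGram N y).det := isUnit_iff_ne_zero.2 h
  rw [kernelMat, Matrix.mul_assoc, Matrix.trace_mul_comm, Matrix.mul_assoc,
    ← lyapunovGram_add_shift, Matrix.mul_add, Matrix.nonsing_inv_mul _ hu, Matrix.mul_smul,
    Matrix.mul_add, Matrix.trace_add, Matrix.trace_smul, Matrix.trace_add,
    Matrix.trace_mul_comm _ ((superShift N)ᵀ * _), Matrix.mul_assoc, Matrix.mul_nonsing_inv _ hu,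
    ← Matrix.mul_assoc, Matrix.nonsing_inv_mul _ hu, Matrix.mul_one, Matrix.one_mul,
    Matrix.trace_transpose, trace_superShift]
  simp

/-- The `2 × 2` principal minors of a positive semidefinite matrix are nonnegative. -/
theorem norm_sq_le_diag_mul_diag {ι : Type*} {K : Matrix ι ι ℂ} (hK : K.PosSemidef) (i j : ι) :
    ‖K i j‖ ^ 2 ≤ (K i i).re * (K j j).re := by
  have h := (hK.submatrix ![i, j]).det_nonneg
  rw [Matrix.det_fin_two] at h
  simp only [Matrix.submatrix_apply, Matrix.cons_val_zero, Matrix.cons_val_one] at h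
  rw [← hK.isHermitian.apply j i, Complex.star_def, Complex.mul_conj] at h
  have hi : (K i i).im = 0 := (Complex.le_def.1 (hK.diag_nonneg (i := i))).2.symm
  have := (Complex.le_def.1 h).1
  rw [Complex.zero_re, Complex.sub_re, Complex.mul_re, hi, zero_mul, sub_zero, Complex.ofReal_re,
    Complex.normSq_eq_norm_sq] at this
  exact sub_nonneg.1 this

theorem diag_re_nonneg {ι : Type*} {K : Matrix ι ι ℂ} (hK : K.PosSemidef) (i : ι) :
    0 ≤ (K i i).re :=
  (Complex.le_def.1 (hK.diag_nonneg (i := i))).1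

/-! ### The extremal configuration: all columns but the first vanish -/

theorem lyapunovGram_single {ι : Type*} [Fintype ι] (N : ℕ) (y : ℕ → ι → ℂ) (β : ι → ℂ)
    (hy : ∀ k < N, y k = if k = 0 then β else 0) :
    lyapunovGram N y = (star β ⬝ᵥ β) • ((pascalMat N)ᵀ * pascalMat N) := by
  ext m k
  rw [lyapunovGram, Matrix.of_apply, Matrix.smul_apply, Matrix.mul_apply]
  rw [Finset.sum_eq_single (m : ℕ), Finset.sum_eq_single (k : ℕ)]
  · rw [Nat.sub_self, Nat.sub_self, hy 0 (by have := m.2; omega), if_pos rfl,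
      lyapunovWeight_eq_sum _ k.2, smul_eq_mul, mul_comm]
    rfl
  · intro l hl hlk
    have := Finset.mem_range.1 hl
    rw [hy (k - l) (by omega), if_neg (by omega)]
    simp
  · simp
  · intro s hs hsm
    have := Finset.mem_range.1 hs
    refine Finset.sum_eq_zero fun l _ => ?_
    rw [hy (m - s) (by omega), if_neg (by omega)]
    simp
  · simp

theorem det_lyapunovGram_single {ι : Type*} [Fintype ι] (N : ℕ) (y : ℕ → ι → ℂ) (β : ι → ℂ)
    (hβ : star β ⬝ᵥ β ≠ 0) (hy : ∀ k < N, y k = if k = 0 then β else 0) :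
    (lyapunovGram N y).det ≠ 0 := by
  rw [lyapunovGram_single N y β hy, Matrix.det_smul, Matrix.det_mul, Matrix.det_transpose]
  have := det_pascalMat_ne_zero N
  exact mul_ne_zero (pow_ne_zero _ hβ) (mul_ne_zero this this)

/-- If all columns but the first vanish, then `K` has rank one, and its trace determines it. -/
theorem kernelMat_single {ι : Type*} [Fintype ι] {N : ℕ} (hN : 1 ≤ N) (y : ℕ → ι → ℂ)
    (β : ι → ℂ) (hβ : star β ⬝ᵥ β ≠ 0) (hy : ∀ k < N, y k = if k = 0 then β else 0) (a b : ι) :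
    kernelMat N y a b = N * (β a * star (β b)) / (star β ⬝ᵥ β) := by
  let o : Fin N := ⟨0, hN⟩
  have hY : colMat N y = Matrix.of fun i k => if k = o then β i else 0 := by
    ext i k
    have : k = o ↔ (k : ℕ) = 0 := Fin.ext_iff
    simp only [colMat, Matrix.of_apply, hy k k.2, this]
    split_ifs <;> rfl
  have hK : ∀ a b, kernelMat N y a b = (lyapunovGram N y)⁻¹ o o * (β a * star (β b)) := by
    intro a b
    rw [kernelMat, hY]
    simp [Matrix.mul_apply, apply_ite (starRingEnd ℂ)]
    ring
  have ht := trace_kernelMat N y (det_lyapunovGram_single N y β hβ hy)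
  have : (lyapunovGram N y)⁻¹ o o * (star β ⬝ᵥ β) = N := by
    rw [← ht, Matrix.trace, dotProduct, Finset.mul_sum]
    exact Finset.sum_congr rfl fun i _ => by rw [Matrix.diag_apply, hK, mul_comm (β i)]; rfl
  rw [hK, ← this]
  field_simp

/-! ### The rogue wave in terms of the matrix `K` -/

theorem MMat_eq_smul_lyapunovGram (n N : ℕ) (lam0 : ℂ)
    (γ : ℕ → Matrix (Fin (n + 1)) (Fin (n + 1)) ℂ) (β : Fin (n + 1) → ℂ) (x t : ℝ) :
    MMat n N lam0 γ β x t = (1 / (I * ((n : ℂ) + 1) * (zeta n lam0 : ℂ))) •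
      lyapunovGram N (PhiTilde n lam0 γ β x t) := rfl

theorem MMat_scalar_ne_zero (n : ℕ) {lam0 : ℂ} (h : lam0.im ≠ 0) :
    I * ((n : ℂ) + 1) * (zeta n lam0 : ℂ) ≠ 0 :=
  mul_ne_zero (mul_ne_zero I_ne_zero (Nat.cast_add_one_ne_zero n))
    (Complex.ofReal_ne_zero.2 (zeta_ne_zero n h))

theorem det_MMat_ne_zero_iff (n N : ℕ) {lam0 : ℂ} (h : lam0.im ≠ 0)
    (γ : ℕ → Matrix (Fin (n + 1)) (Fin (n + 1)) ℂ) (β : Fin (n + 1) → ℂ) (x t : ℝ) :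
    (MMat n N lam0 γ β x t).det ≠ 0 ↔ (lyapunovGram N (PhiTilde n lam0 γ β x t)).det ≠ 0 := by
  rw [MMat_eq_smul_lyapunovGram, Matrix.det_smul]
  exact ⟨right_ne_zero_of_mul,
    mul_ne_zero (pow_ne_zero _ (one_div_ne_zero (MMat_scalar_ne_zero n h)))⟩

/-- Expanding the bordered determinant by a Schur complement expresses the rogue wave through an
entry of `K`. -/
theorem qN_eq (n N : ℕ) {lam0 : ℂ} (h : lam0.im ≠ 0)
    (γ : ℕ → Matrix (Fin (n + 1)) (Fin (n + 1)) ℂ) (β : Fin (n + 1) → ℂ) (x t : ℝ) (j : Fin n)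
    (hM : (MMat n N lam0 γ β x t).det ≠ 0) :
    qN n N lam0 γ β x t j = qbg n lam0 x t j - 2 * (I * ((n : ℂ) + 1) * (zeta n lam0 : ℂ)) *
      kernelMat N (PhiTilde n lam0 γ β x t) j.succ 0 := by
  have hc := MMat_scalar_ne_zero n h
  have hP := (det_MMat_ne_zero_iff n N h γ β x t).1 hM
  have hinv : (MMat n N lam0 γ β x t)⁻¹ = (I * ((n : ℂ) + 1) * (zeta n lam0 : ℂ)) •
      (lyapunovGram N (PhiTilde n lam0 γ β x t))⁻¹ := by
    refine Matrix.inv_eq_right_inv ?_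
    rw [MMat_eq_smul_lyapunovGram, Matrix.smul_mul, Matrix.mul_smul, smul_smul,
      Matrix.mul_nonsing_inv _ (isUnit_iff_ne_zero.2 hP), one_div_mul_cancel hc, one_smul]
  let := Matrix.invertibleOfIsUnitDet _ (isUnit_iff_ne_zero.2 hM)
  rw [qN, Matrix.det_fromBlocks₁₁, Matrix.invOf_eq_nonsing_inv, hinv, zero_sub,
    Matrix.mul_smul, Matrix.smul_mul, mul_comm (MMat n N lam0 γ β x t).det, ← mul_assoc,
    mul_div_cancel_right₀ _ hM, Matrix.det_unique, sub_eq_add_neg]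
  -- The Schur complement is a `1 × 1` matrix.
  have e : (Matrix.replicateRow Unit (YMat n N lam0 γ β x t j.succ) *
      (lyapunovGram N (PhiTilde n lam0 γ β x t))⁻¹ *
      Matrix.replicateCol Unit (star (YMat n N lam0 γ β x t 0))) default default =
      kernelMat N (PhiTilde n lam0 γ β x t) j.succ 0 := rfl
  rw [Matrix.neg_apply, Matrix.smul_apply, e, smul_eq_mul]
  ring

theorem norm_qbg (n : ℕ) (lam0 : ℂ) (x t : ℝ) (j : Fin n) :
    ‖qbg n lam0 x t j‖ = |amp n lam0 j| := by
  rw [qbg, norm_mul, mul_comm I, Complex.norm_exp_ofReal_mul_I, mul_one, Complex.norm_real,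
    Real.norm_eq_abs]

theorem abs_amp (n : ℕ) (lam0 : ℂ) (j : Fin n) :
    |amp n lam0 j| = |zeta n lam0| * (1 / Real.sin (omega n j)) := by
  rw [amp, abs_div, abs_of_pos (sin_omega_pos n j), mul_one_div]

theorem norm_qN_le (n N : ℕ) {lam0 : ℂ} (h : lam0.im ≠ 0)
    (γ : ℕ → Matrix (Fin (n + 1)) (Fin (n + 1)) ℂ) (β : Fin (n + 1) → ℂ) (x t : ℝ) (j : Fin n)
    (hM : (MMat n N lam0 γ β x t).det ≠ 0) :
    ‖qN n N lam0 γ β x t j‖ ≤ |zeta n lam0| * (1 / Real.sin (omega n j) +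
      2 * (n + 1) * ‖kernelMat N (PhiTilde n lam0 γ β x t) j.succ 0‖) := by
  rw [qN_eq n N h γ β x t j hM]
  refine (norm_sub_le _ _).trans (le_of_eq ?_)
  rw [norm_qbg, abs_amp, norm_mul, norm_mul, norm_mul, norm_mul, Complex.norm_I, Complex.norm_real,
    Real.norm_eq_abs, Complex.norm_ofNat,
    show ‖(n : ℂ) + 1‖ = (n : ℝ) + 1 by exact_mod_cast Complex.norm_natCast (n + 1)]
  ring

/-! ### Upper bounds from the trace -/

theorem trace_re_kernelMat {n N : ℕ} {y : ℕ → Fin (n + 1) → ℂ}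
    (h : (lyapunovGram N y).det ≠ 0) :
    (kernelMat N y 0 0).re + ∑ j : Fin n, (kernelMat N y j.succ j.succ).re = N := by
  have := congrArg Complex.re (trace_kernelMat N y h)
  rw [Matrix.trace, Fin.sum_univ_succ, Complex.add_re, Complex.re_sum] at this
  simpa using this

/-- The entry is at most the geometric mean of two diagonal entries, which are nonnegative and add
up to at most the trace `N`. -/
theorem norm_kernelMat_le {n N : ℕ} {y : ℕ → Fin (n + 1) → ℂ}
    (h : (lyapunovGram N y).det ≠ 0) (j : Fin n) : ‖kernelMat N y j.succ 0‖ ≤ N / 2 := by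
  have hK := kernelMat_posSemidef N y
  have h1 := norm_sq_le_diag_mul_diag hK j.succ 0
  have h2 := trace_re_kernelMat h
  have h3 := Finset.single_le_sum (f := fun j : Fin n => (kernelMat N y j.succ j.succ).re)
    (fun i _ => diag_re_nonneg hK i.succ) (Finset.mem_univ j)
  have h4 := diag_re_nonneg hK j.succ
  have h5 := diag_re_nonneg hK (0 : Fin (n + 1))
  refine le_of_sq_le_sq ?_ (by positivity)
  nlinarith [sq_nonneg ((kernelMat N y j.succ j.succ).re - (kernelMat N y 0 0).re)]

/-- With `d` the first diagonal entry of `K`, the remaining ones add up to `N - d`, so the sum is at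
most `√(n d (N - d))` by the inequality of Cauchy and Schwarz. -/
theorem sum_norm_kernelMat_le {n N : ℕ} {y : ℕ → Fin (n + 1) → ℂ}
    (h : (lyapunovGram N y).det ≠ 0) :
    ∑ j : Fin n, ‖kernelMat N y j.succ 0‖ ≤ Real.sqrt n * (N / 2) := by
  have hK := kernelMat_posSemidef N y
  have h1 : ∑ j : Fin n, ‖kernelMat N y j.succ 0‖ ^ 2 ≤
      (∑ j : Fin n, (kernelMat N y j.succ j.succ).re) * (kernelMat N y 0 0).re := by
    rw [Finset.sum_mul]
    exact Finset.sum_le_sum fun j _ => norm_sq_le_diag_mul_diag hK j.succ 0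
  have h2 := trace_re_kernelMat h
  have h3 := sq_sum_le_card_mul_sum_sq (s := Finset.univ)
    (f := fun j : Fin n => ‖kernelMat N y j.succ 0‖)
  rw [Finset.card_univ, Fintype.card_fin] at h3
  refine le_of_sq_le_sq ?_ (by positivity)
  rw [mul_pow, Real.sq_sqrt (Nat.cast_nonneg n)]
  refine h3.trans (mul_le_mul_of_nonneg_left (h1.trans ?_) (Nat.cast_nonneg n))
  rw [← h2]
  nlinarith [sq_nonneg ((kernelMat N y 0 0).re -
    ∑ j : Fin n, (kernelMat N y j.succ j.succ).re)]

theorem compRatio_le (n N : ℕ) {lam0 : ℂ} (h : lam0.im ≠ 0)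
    (γ : ℕ → Matrix (Fin (n + 1)) (Fin (n + 1)) ℂ) (β : Fin (n + 1) → ℂ) (x t : ℝ) (j : Fin n)
    (hM : (MMat n N lam0 γ β x t).det ≠ 0) :
    compRatio n N lam0 γ β x t j ≤ 1 + N * (n + 1) * Real.sin (omega n j) := by
  have hs := sin_omega_pos n j
  have hz := abs_pos.2 (zeta_ne_zero n h)
  rw [compRatio, norm_div, Complex.norm_real, Real.norm_eq_abs,
    div_le_iff₀ (abs_pos.2 (amp_ne_zero n h j))]
  refine (norm_qN_le n N h γ β x t j hM).trans ?_
  have hK := norm_kernelMat_le ((det_MMat_ne_zero_iff n N h γ β x t).1 hM) j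
  calc _ ≤ |zeta n lam0| * (1 / Real.sin (omega n j) + 2 * (n + 1) * (N / 2)) := by gcongr
    _ = _ := by
      rw [abs_amp]
      field_simp

theorem sum_csc_pos {n : ℕ} (hn : 1 ≤ n) : 0 < ∑ j : Fin n, 1 / Real.sin (omega n j) :=
  Finset.sum_pos (fun j _ => one_div_pos.2 (sin_omega_pos n j)) ⟨⟨0, hn⟩, Finset.mem_univ _⟩

theorem sum_abs_amp (n : ℕ) (lam0 : ℂ) : ∑ j : Fin n, |amp n lam0 j| =
    |zeta n lam0| * ∑ j : Fin n, 1 / Real.sin (omega n j) := by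
  simp only [abs_amp, Finset.mul_sum]

theorem avgRatio_le {n : ℕ} (hn : 1 ≤ n) (N : ℕ) {lam0 : ℂ} (h : lam0.im ≠ 0)
    (γ : ℕ → Matrix (Fin (n + 1)) (Fin (n + 1)) ℂ) (β : Fin (n + 1) → ℂ) (x t : ℝ)
    (hM : (MMat n N lam0 γ β x t).det ≠ 0) :
    avgRatio n N lam0 γ β x t ≤
      1 + N * (n + 1) * Real.sqrt n / ∑ j : Fin n, 1 / Real.sin (omega n j) := by
  have hz := abs_pos.2 (zeta_ne_zero n h)
  have hC := sum_csc_pos hn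
  rw [avgRatio, sum_abs_amp, div_le_iff₀ (mul_pos hz hC)]
  refine (Finset.sum_le_sum fun j _ => norm_qN_le n N h γ β x t j hM).trans ?_
  rw [← Finset.mul_sum, Finset.sum_add_distrib, ← Finset.mul_sum]
  have hK := sum_norm_kernelMat_le ((det_MMat_ne_zero_iff n N h γ β x t).1 hM)
  set C := ∑ j : Fin n, 1 / Real.sin (omega n j)
  calc _ ≤ |zeta n lam0| * (C + 2 * (n + 1) * (Real.sqrt n * (N / 2))) := by gcongr
    _ = _ := by field_simp

/-! ### Attainment at the origin -/

/-- The choice of the `γ_m` makes `(∑ Φ̂_s ε^s) (∑ γ_s ε^s) = 1` up to order `N - 1`. -/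
theorem PhiTilde_origin {n N : ℕ} {lam0 : ℂ} (h : lam0.im ≠ 0)
    {γ : ℕ → Matrix (Fin (n + 1)) (Fin (n + 1)) ℂ}
    (hγ0 : γ 0 = (PhiHat n lam0 0 0 0)⁻¹)
    (hγ : ∀ m : ℕ, 1 ≤ m → m < N →
      γ m = -((PhiHat n lam0 0 0 0)⁻¹ *
        ∑ s ∈ Finset.range m, PhiHat n lam0 0 0 (m - s) * γ s))
    (β : Fin (n + 1) → ℂ) {k : ℕ} (hk : k < N) :
    PhiTilde n lam0 γ β 0 0 k = if k = 0 then β else 0 := by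
  have hu := (Matrix.isUnit_iff_isUnit_det _).1 (PhiHat_zero_isUnit n h)
  rw [PhiTilde, ← Finset.sum_range_reflect, ← Matrix.sum_mulVec]
  have e : ∑ j ∈ Finset.range (k + 1), PhiHat n lam0 0 0 (k + 1 - 1 - j) *
      γ (k - (k + 1 - 1 - j)) =
      ∑ j ∈ Finset.range (k + 1), PhiHat n lam0 0 0 (k - j) * γ j :=
    Finset.sum_congr rfl fun j hj => by
      have := Finset.mem_range.1 hj
      rw [Nat.add_sub_cancel, Nat.sub_sub_self (by omega)]
  rw [e, Finset.sum_range_succ, Nat.sub_self]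
  split_ifs with h0
  · subst h0
    rw [Finset.sum_range_zero, zero_add, hγ0, Matrix.mul_nonsing_inv _ hu, Matrix.one_mulVec]
  · rw [hγ k (by omega) hk, Matrix.mul_neg, ← Matrix.mul_assoc, Matrix.mul_nonsing_inv _ hu,
      Matrix.one_mul, add_neg_cancel, Matrix.zero_mulVec]

theorem qbg_origin (n : ℕ) (lam0 : ℂ) (j : Fin n) : qbg n lam0 0 0 j = (amp n lam0 j : ℂ) := by
  simp [qbg, phase]

theorem det_MMat_origin_ne_zero {n N : ℕ} {lam0 : ℂ} (h : lam0.im ≠ 0)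
    {γ : ℕ → Matrix (Fin (n + 1)) (Fin (n + 1)) ℂ} {β : Fin (n + 1) → ℂ}
    (hβ : star β ⬝ᵥ β ≠ 0)
    (hy : ∀ k < N, PhiTilde n lam0 γ β 0 0 k = if k = 0 then β else 0) :
    (MMat n N lam0 γ β 0 0).det ≠ 0 :=
  (det_MMat_ne_zero_iff n N h γ β 0 0).2 (det_lyapunovGram_single N _ β hβ hy)

theorem qN_origin {n N : ℕ} (hN : 1 ≤ N) {lam0 : ℂ} (h : lam0.im ≠ 0)
    {γ : ℕ → Matrix (Fin (n + 1)) (Fin (n + 1)) ℂ} {β : Fin (n + 1) → ℂ}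
    (hβ : star β ⬝ᵥ β ≠ 0)
    (hy : ∀ k < N, PhiTilde n lam0 γ β 0 0 k = if k = 0 then β else 0) (j : Fin n) :
    qN n N lam0 γ β 0 0 j = (amp n lam0 j : ℂ) - 2 * (I * ((n : ℂ) + 1) * (zeta n lam0 : ℂ)) *
      (N * (β j.succ * star (β 0)) / (star β ⬝ᵥ β)) := by
  rw [qN_eq n N h γ β 0 0 j (det_MMat_origin_ne_zero h hβ hy), qbg_origin,
    kernelMat_single hN _ β hβ hy]

theorem star_eta_dotProduct_eta (n : ℕ) : star (eta n) ⬝ᵥ eta n = 2 * (n : ℂ) := by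
  rw [dotProduct, Fin.sum_univ_succ]
  simp only [Pi.star_apply, eta, Fin.cons_zero, Fin.cons_succ, Complex.star_def,
    Complex.conj_ofReal, Complex.conj_I, neg_mul, Complex.I_mul_I, neg_neg, Finset.sum_const,
    Finset.card_univ, Fintype.card_fin, nsmul_eq_mul, mul_one]
  rw [← Complex.ofReal_mul, Real.mul_self_sqrt (Nat.cast_nonneg n)]
  push_cast
  ring

theorem star_etaComp_dotProduct_etaComp (n : ℕ) (j : Fin n) :
    star (etaComp n j) ⬝ᵥ etaComp n j = 2 := by
  rw [dotProduct, Fin.sum_univ_succ]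
  simp only [Pi.star_apply, etaComp, Fin.cons_zero, Fin.cons_succ]
  rw [Finset.sum_eq_single j]
  · simp [one_add_one_eq_two]
  · intro i _ hij
    simp [hij]
  · simp

theorem norm_qN_origin_eta {n N : ℕ} (hn : 1 ≤ n) (hN : 1 ≤ N) {lam0 : ℂ} (h : lam0.im ≠ 0)
    {γ : ℕ → Matrix (Fin (n + 1)) (Fin (n + 1)) ℂ}
    (hy : ∀ k < N, PhiTilde n lam0 γ (eta n) 0 0 k = if k = 0 then eta n else 0) (j : Fin n) :
    ‖qN n N lam0 γ (eta n) 0 0 j‖ =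
      |zeta n lam0| * (1 / Real.sin (omega n j) + (n + 1) * N * Real.sqrt n / n) := by
  have hn0 : (n : ℂ) ≠ 0 := Nat.cast_ne_zero.2 (by omega)
  have hs := sin_omega_pos n j
  have hβ : star (eta n) ⬝ᵥ eta n ≠ 0 := by
    rw [star_eta_dotProduct_eta]
    exact mul_ne_zero two_ne_zero hn0
  have e : qN n N lam0 γ (eta n) 0 0 j = ((zeta n lam0 *
      (1 / Real.sin (omega n j) + (n + 1) * N * Real.sqrt n / n) : ℝ) : ℂ) := by
    rw [qN_origin hN h hβ hy, star_eta_dotProduct_eta, amp]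
    simp only [eta, Fin.cons_zero, Fin.cons_succ, Complex.star_def, Complex.conj_ofReal]
    push_cast
    field_simp
    linear_combination (-(zeta n lam0 : ℂ) * N * (n + 1) * (Real.sqrt n : ℂ)) *
      Complex.I_sq
  rw [e, Complex.norm_real, Real.norm_eq_abs, abs_mul]
  congr 1
  exact abs_of_nonneg (by positivity)

theorem avgRatio_origin_eta {n N : ℕ} (hn : 1 ≤ n) (hN : 1 ≤ N) {lam0 : ℂ} (h : lam0.im ≠ 0)
    {γ : ℕ → Matrix (Fin (n + 1)) (Fin (n + 1)) ℂ}
    (hy : ∀ k < N, PhiTilde n lam0 γ (eta n) 0 0 k = if k = 0 then eta n else 0) :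
    avgRatio n N lam0 γ (eta n) 0 0 =
      1 + N * (n + 1) * Real.sqrt n / ∑ j : Fin n, 1 / Real.sin (omega n j) := by
  have hn0 : (n : ℝ) ≠ 0 := Nat.cast_ne_zero.2 (by omega)
  have hz := (abs_pos.2 (zeta_ne_zero n h)).ne'
  have hC := (sum_csc_pos hn).ne'
  rw [avgRatio, sum_abs_amp]
  simp only [norm_qN_origin_eta hn hN h hy]
  rw [← Finset.mul_sum, Finset.sum_add_distrib, Finset.sum_const, Finset.card_univ,
    Fintype.card_fin, nsmul_eq_mul]
  set C := ∑ j : Fin n, 1 / Real.sin (omega n j)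
  field_simp

theorem compRatio_origin_etaComp {n N : ℕ} (hN : 1 ≤ N) {lam0 : ℂ} (h : lam0.im ≠ 0)
    {γ : ℕ → Matrix (Fin (n + 1)) (Fin (n + 1)) ℂ} (j : Fin n)
    (hy : ∀ k < N, PhiTilde n lam0 γ (etaComp n j) 0 0 k = if k = 0 then etaComp n j else 0) :
    compRatio n N lam0 γ (etaComp n j) 0 0 j = 1 + N * (n + 1) * Real.sin (omega n j) := by
  have hs := sin_omega_pos n j
  have hs' : (Real.sin (omega n j) : ℂ) ≠ 0 := Complex.ofReal_ne_zero.2 hs.ne'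
  have hz : (zeta n lam0 : ℂ) ≠ 0 := Complex.ofReal_ne_zero.2 (zeta_ne_zero n h)
  have hβ : star (etaComp n j) ⬝ᵥ etaComp n j ≠ 0 := by
    rw [star_etaComp_dotProduct_etaComp]
    exact two_ne_zero
  have e : qN n N lam0 γ (etaComp n j) 0 0 j / (amp n lam0 j : ℂ) =
      ((1 + N * (n + 1) * Real.sin (omega n j) : ℝ) : ℂ) := by
    rw [qN_origin hN h hβ hy, star_etaComp_dotProduct_etaComp, amp]
    simp only [etaComp, Fin.cons_zero, Fin.cons_succ, Pi.single_eq_same, star_one, mul_one]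
    push_cast at hs' ⊢
    field_simp
    linear_combination (-(N : ℂ) * (n + 1) * Complex.sin (omega n j)) * Complex.I_sq
  rw [compRatio, e, Complex.norm_real, Real.norm_eq_abs]
  exact abs_of_nonneg (by positivity)

end VectorRogue

open VectorRogue
theorem mainTheorem7 (n N : ℕ) (hn : 1 ≤ n) (hN : 1 ≤ N) (lam0 : ℂ)
    (hre : lam0.re = 0) (him : lam0.im ≠ 0)
    (γ : ℕ → Matrix (Fin (n + 1)) (Fin (n + 1)) ℂ)
    (hγ0 : γ 0 = (PhiHat n lam0 0 0 0)⁻¹)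
    (hγ : ∀ m : ℕ, 1 ≤ m → m < N →
      γ m = -((PhiHat n lam0 0 0 0)⁻¹ *
        ∑ s ∈ Finset.range m, PhiHat n lam0 0 0 (m - s) * γ s)) :
    IsUnit (PhiHat n lam0 0 0 0) ∧
    (∀ (β : Fin (n + 1) → ℂ) (k : ℕ), k < N →
      PhiTilde n lam0 γ β 0 0 k = if k = 0 then β else 0) ∧
    ((MMat n N lam0 γ (eta n) 0 0).det ≠ 0 ∧
      avgRatio n N lam0 γ (eta n) 0 0
        = 1 + N * (n + 1) * Real.sqrt n / ∑ j : Fin n, 1 / Real.sin (omega n j) ∧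
      IsGreatest (avgRatioSet n N lam0)
        (1 + N * (n + 1) * Real.sqrt n / ∑ j : Fin n, 1 / Real.sin (omega n j))) ∧
    (∀ j : Fin n,
      (MMat n N lam0 γ (etaComp n j) 0 0).det ≠ 0 ∧
      compRatio n N lam0 γ (etaComp n j) 0 0 j = 1 + N * (n + 1) * Real.sin (omega n j) ∧
      IsGreatest (compRatioSet n N lam0 j) (1 + N * (n + 1) * Real.sin (omega n j))) := by
  have hy := fun β k hk => PhiTilde_origin (k := k) him hγ0 hγ β hk
  refine ⟨PhiHat_zero_isUnit n him, hy, ?_, fun j => ?_⟩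
  · have hdet := det_MMat_origin_ne_zero him (by
      rw [star_eta_dotProduct_eta]
      exact mul_ne_zero two_ne_zero (Nat.cast_ne_zero.2 (by omega))) (hy (eta n))
    have heq := avgRatio_origin_eta hn hN him (hy (eta n))
    refine ⟨hdet, heq, ⟨γ, eta n, 0, 0, hdet, heq.symm⟩, ?_⟩
    rintro r ⟨γ', β, x, t, hM, rfl⟩
    exact avgRatio_le hn N him γ' β x t hM
  · have hdet := det_MMat_origin_ne_zero him (by
      rw [star_etaComp_dotProduct_etaComp]
      exact two_ne_zero) (hy (etaComp n j))
    have heq := compRatio_origin_etaComp hN him j (hy (etaComp n j))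
    refine ⟨hdet, heq, ⟨γ, etaComp n j, 0, 0, hdet, heq.symm⟩, ?_⟩
    rintro r ⟨γ', β, x, t, hM, rfl⟩
    exact compRatio_le n N him γ' β x t j hM
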